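/- A PDFA with $n$ states over a finite alphabet $\Sigma$ has an initial state and, for each state $q$, probabilities $\gamma(q,\sigma)$ ($\sigma\in\Sigma$) and $\gamma(q,\mathrm{end})$ that sum to $1$, and a next state $\tau(q,\sigma)$ for each $\sigma \in \Sigma$; in state $q$ it emits $\sigma$ with probability $\gamma(q,\sigma)$ and moves to $\tau(q,\sigma)$, or ends the word with probability $\gamma(q,\mathrm{end})$. It is required to end with probability $1$, so that it generates a probability distribution on $\Sigma^*$. For a function $v:\{0,1\}^\ell\to\mathbb{Q}_{\ge 0}$ (the number that an $\ell$-bit string stands for), let $\mathcal{D}_{n,\Sigma,v}$ be the class of distributions on $\Sigma^*$ generated by PDFAs with $n$ states over $\Sigma$ all of whose probabilities $\gamma(q,\cdot)$ are values of $v$. There is a polynomial $p$ in five variables with coefficients in $\mathbb{N}$ such that, for all $n,\ell$, all finite alphabets $\Sigma$ and all $v:\{0,1\}^\ell\to\mathbb{Q}_{\ge 0}$, the class $\mathcal{D}_{n,\Sigma,v}$ has a learning algorithm, of unrestricted running time, with the following property. For all real $\epsilon,\delta>0$ and every $D\in\mathcal{D}_{n,\Sigma,v}$, given $\lceil 1/\epsilon\rceil$,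 $\lceil 1/\delta\rceil$ and a sample of \[ m = p\bigl(n,|\Sigma|,\ell,\lceil 1/\epsilon\rceil,\lceil 1/\delta\rceil\bigr) \] words drawn independently from $D$, the algorithm returns a probability distribution $D'$ on $\Sigma^*$ that satisfies, with probability at least $1-\delta$ over the sample, \[ I(D\,\|\,D')=\sum_{x\in\Sigma^*}D(x)\log\frac{D(x)}{D'(x)}\le\epsilon . \] (The sum is read as $+\infty$ if $D(x)>0=D'(x)$ for some $x$, and terms with $D(x)=0$ are $0$.) Here the algorithm is deterministic and returns $D'$ through an evaluator: a single computable function takes $\lceil 1/\epsilon\rceil$, $\lceil 1/\delta\rceil$, the sample and a word $x\in\Sigma^*$ to the rational number $D'(x)$. -/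

import Mathlib

open scoped NNReal ENNReal

/-- The weight of the word `w` read from the state `q`: the product of the probabilities of the
successive symbols and of the end marker `none` emitted after the last one. -/
def pdfaWeight {n : ℕ} {α : Type*} (next : Fin n → α → Fin n)
    (prob : Fin n → Option α → ℝ≥0) : Fin n → List α → ℝ≥0
  | q, [] => prob q none
  | q, a :: w => prob q (some a) * pdfaWeight next prob (next q a) w

/-- A probabilistic deterministic finite automaton with `n` states over the alphabet `α`.
In state `q` it emits the symbol `a` with probability `prob q (some a)` and moves to `next q a`,
or it ends the word with probability `prob q none`. With probability one a run from the
initial state ends after finitely many steps. -/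
structure PDFA (n : ℕ) (α : Type*) [Fintype α] where
  start : Fin n
  next : Fin n → α → Fin n
  prob : Fin n → Option α → ℝ≥0
  sum_prob : ∀ q, ∑ o, prob q o = 1
  terminates : HasSum (fun w : List α => pdfaWeight next prob start w) 1

/-- The distribution on words generated by a PDFA. -/
noncomputable def PDFA.dist {n : ℕ} {α : Type*} [Fintype α] (A : PDFA n α) : PMF (List α) :=
  ⟨fun w => (pdfaWeight A.next A.prob A.start w : ℝ≥0∞), by
    simpa using ENNReal.hasSum_coe.mpr A.terminates⟩

/-- All probabilities of `A` are given by bit strings of length `l`, where the bit string `b`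
stands for the number `val b`. -/
def PDFA.HasBitProbs {n : ℕ} {α : Type*} [Fintype α] {l : ℕ} (A : PDFA n α)
    (val : (Fin l → Bool) → ℚ≥0) : Prop :=
  ∀ q o, ∃ b, A.prob q o = (val b : ℝ≥0)

/-- The Kullback-Leibler divergence `I(D || D')` of distributions on a discrete domain. -/
noncomputable def klDivergence {X : Type*} (D D' : PMF X) : ℝ≥0∞ :=
  @InformationTheory.klDiv X ⊤ (@PMF.toMeasure X ⊤ D) (@PMF.toMeasure X ⊤ D')

/-- The law of a sample of `m` independent draws from `D`. -/
noncomputable def iidSample {X : Type*} (D : PMF X) : ℕ → PMF (List X)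
  | 0 => PMF.pure []
  | m + 1 => D.bind fun x => (iidSample D m).map fun S => x :: S

/-- `H a b S` is the hypothesis returned on the sample `S` for the accuracy parameter `a` and the
confidence parameter `b`. The learner `H` is an algorithm: one computable function takes
`a`, `b`, `S` and a point `x` to a fraction (numerator, denominator) that is the probability
of `x` under the hypothesis. -/
def IsComputableLearner {X : Type*} [Primcodable X] (H : ℕ → ℕ → List X → PMF X) : Prop :=
  ∃ f : (ℕ × ℕ × List X) × X → ℕ × ℕ, Computable f ∧
    ∀ a b S x, H a b S x = ((f ((a, b, S), x)).1 : ℝ≥0∞) / ((f ((a, b, S), x)).2 : ℝ≥0∞)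

/-! Finitely many automata meet the bit constraint, and the logarithm of their number is polynomial
in `n`, `|Σ|` and `l`. It therefore suffices to learn a finite class with about `log card / (ε δ)`
words.

Start from the uniform prior on the class and predict each word by the posterior mixture. The
expected loss of one prediction equals the expected decrease of the log inverse posterior of the
true hypothesis (`predictiveLoss_add_le`). This potential starts at `log card` and stays
nonnegative, so the losses telescope to at most `log card` in expectation
(`tsum_iidSample_mul_cumulativeLoss_le`). By convexity of the divergence, the average of the `m + 1`
predictions has expected divergence at most `log card / (m + 1)`; Markov's inequality finishes the
bound.

The class is fixed, so its automata can be built into the learner. Over a common denominator all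
probabilities become integer weights, and the evaluator uses only integer arithmetic. -/

/-! ### Termwise Kullback-Leibler divergence -/

/-- The term `d * log (d / p) + p - d` of the Kullback-Leibler divergence of finite measures on a
discrete space. -/
noncomputable def klTerm (d p : ℝ≥0∞) : ℝ≥0∞ :=
  -- The value must be set by hand: the real conventions `d / 0 = 0` and `log 0 = 0` would make it
  -- finite.
  if p = 0 ∧ d ≠ 0 then ⊤ else
    ENNReal.ofReal (d.toReal * Real.log (d.toReal / p.toReal) + p.toReal - d.toReal)

lemma klTerm_of_ne_zero {d p : ℝ≥0∞} (hp : p ≠ 0) :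
    klTerm d p =
      ENNReal.ofReal (d.toReal * Real.log (d.toReal / p.toReal) + p.toReal - d.toReal) :=
  if_neg fun h => hp h.1

lemma klTerm_zero_left {p : ℝ≥0∞} (hp : p ≠ ⊤) : klTerm 0 p = p := by
  simp [klTerm, hp]

lemma klTerm_zero_right {d : ℝ≥0∞} (hd : d ≠ 0) : klTerm d 0 = ⊤ := by
  simp [klTerm, hd]

lemma mul_log_div_add_sub_nonneg {d p : ℝ} (hd : 0 ≤ d) (hp : 0 < p) :
    0 ≤ d * Real.log (d / p) + p - d := by
  have h := mul_nonneg hp.le (InformationTheory.klFun_nonneg (div_nonneg hd hp.le))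
  have e : p * InformationTheory.klFun (d / p) = d * Real.log (d / p) + p - d := by
    rw [InformationTheory.klFun_apply]
    field_simp
  rwa [e] at h

lemma klTerm_mul {c d p : ℝ≥0∞} (hc : c ≠ 0) (hc' : c ≠ ⊤) :
    klTerm (c * d) (c * p) = c * klTerm d p := by
  by_cases hp : p = 0
  · by_cases hd : d = 0
    · simp [klTerm, hp, hd]
    · rw [hp, mul_zero, klTerm_zero_right (mul_ne_zero hc hd), klTerm_zero_right hd,
        ENNReal.mul_top hc]
  · rw [klTerm_of_ne_zero hp, klTerm_of_ne_zero (mul_ne_zero hc hp)]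
    have hc0 : c.toReal ≠ 0 := ENNReal.toReal_ne_zero.2 ⟨hc, hc'⟩
    conv_rhs => rw [← ENNReal.ofReal_toReal hc', ← ENNReal.ofReal_mul ENNReal.toReal_nonneg]
    rw [ENNReal.toReal_mul, ENNReal.toReal_mul, mul_div_mul_left _ _ hc0]
    ring_nf

/-- The log-sum inequality. With `klTerm_mul` it gives the joint convexity used for averaging
predictions. -/
lemma klTerm_add_le {d₁ d₂ p₁ p₂ : ℝ≥0∞} (hd₁ : d₁ ≠ ⊤) (hd₂ : d₂ ≠ ⊤) (hp₁ : p₁ ≠ ⊤)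
    (hp₂ : p₂ ≠ ⊤) : klTerm (d₁ + d₂) (p₁ + p₂) ≤ klTerm d₁ p₁ + klTerm d₂ p₂ := by
  have key : ∀ {d p e q : ℝ}, 0 ≤ d → 0 < p → 0 ≤ e → 0 < q →
      -- This is `1 - 1 / t ≤ log t` times `d`. Adding the two symmetric instances cancels the left
      -- sides.
      d - p * ((d + e) / (p + q)) ≤ d * Real.log (d / p) - d * Real.log ((d + e) / (p + q)) := by
    intro d p e q hd hp he hq
    rcases hd.eq_or_lt with rfl | hd
    · have : 0 ≤ p * (e / (p + q)) := by positivity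
      simpa using this
    · have h := Real.one_sub_inv_le_log_of_pos (x := (d / p) / ((d + e) / (p + q))) (by positivity)
      rw [Real.log_div (by positivity) (by positivity)] at h
      have h' := mul_le_mul_of_nonneg_left h hd.le
      have e1 : d * (1 - ((d / p) / ((d + e) / (p + q)))⁻¹) = d - p * ((d + e) / (p + q)) := by
        field_simp
      rw [e1, mul_sub] at h'
      exact h'
  by_cases h₁ : p₁ = 0
  · by_cases h : d₁ = 0
    · simp [h₁, h]
    · simp [h₁, klTerm_zero_right h]
  by_cases h₂ : p₂ = 0
  · by_cases h : d₂ = 0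
    · simp [h₂, h]
    · simp [h₂, klTerm_zero_right h]
  rw [klTerm_of_ne_zero h₁, klTerm_of_ne_zero h₂, klTerm_of_ne_zero (by simp [h₁])]
  have q₁ := ENNReal.toReal_pos h₁ hp₁
  have q₂ := ENNReal.toReal_pos h₂ hp₂
  have e₁ : 0 ≤ d₁.toReal := ENNReal.toReal_nonneg
  have e₂ : 0 ≤ d₂.toReal := ENNReal.toReal_nonneg
  rw [← ENNReal.ofReal_add (mul_log_div_add_sub_nonneg e₁ q₁) (mul_log_div_add_sub_nonneg e₂ q₂),
    ENNReal.toReal_add hd₁ hd₂, ENNReal.toReal_add hp₁ hp₂]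
  apply ENNReal.ofReal_le_ofReal
  have k₁ := key e₁ q₁ e₂ q₂
  have k₂ := key e₂ q₂ e₁ q₁
  rw [add_comm d₂.toReal d₁.toReal, add_comm p₂.toReal p₁.toReal] at k₂
  have k₃ : p₁.toReal * ((d₁.toReal + d₂.toReal) / (p₁.toReal + p₂.toReal)) +
    p₂.toReal * ((d₁.toReal + d₂.toReal) / (p₁.toReal + p₂.toReal)) = d₁.toReal + d₂.toReal := by
    field_simp
  linarith

/-- One step of the telescoping: if `r` is the posterior of the truth, `r * d / p` is its posterior
after the new point. Terms are moved across so that no subtraction occurs in `ℝ≥0∞`. -/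
lemma klTerm_add_mul_log {d p : ℝ≥0∞} {r : ℝ} (hd : d ≠ ⊤) (hp : p ≠ ⊤) (hr : 0 < r)
    (hr' : r ≤ 1) (h : r * d.toReal ≤ p.toReal) :
    klTerm d p + d * ENNReal.ofReal (Real.log (p.toReal / (r * d.toReal))) + d =
      d * ENNReal.ofReal (Real.log (1 / r)) + p := by
  by_cases hd0 : d = 0
  · simp [hd0, klTerm_zero_left hp]
  have dpos := ENNReal.toReal_pos hd0 hd
  have ppos : 0 < p.toReal := lt_of_lt_of_le (by positivity) h
  have hp0 : p ≠ 0 := (ENNReal.toReal_ne_zero.1 ppos.ne').1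
  rw [klTerm_of_ne_zero hp0]
  have l₁ : 0 ≤ Real.log (p.toReal / (r * d.toReal)) :=
    Real.log_nonneg ((one_le_div (by positivity)).2 h)
  have l₂ : 0 ≤ Real.log (1 / r) := Real.log_nonneg ((one_le_div hr).2 hr')
  have l₃ := mul_log_div_add_sub_nonneg dpos.le ppos
  obtain ⟨x, hx, rfl⟩ : ∃ x : ℝ, 0 < x ∧ ENNReal.ofReal x = d :=
    ⟨_, dpos, ENNReal.ofReal_toReal hd⟩
  obtain ⟨y, hy, rfl⟩ : ∃ y : ℝ, 0 < y ∧ ENNReal.ofReal y = p :=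
    ⟨_, ppos, ENNReal.ofReal_toReal hp⟩
  rw [ENNReal.toReal_ofReal hx.le, ENNReal.toReal_ofReal hy.le] at *
  rw [← ENNReal.ofReal_mul hx.le, ← ENNReal.ofReal_mul hx.le, ← ENNReal.ofReal_add l₃ (by positivity),
    ← ENNReal.ofReal_add (by positivity) hx.le, ← ENNReal.ofReal_add (by positivity) hy.le]
  congr 1
  rw [Real.log_div hx.ne' hy.ne', Real.log_div hy.ne' (by positivity),
    Real.log_mul hr.ne' hx.ne', Real.log_div one_ne_zero hr.ne', Real.log_one]
  ring

open MeasureTheory in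
-- The density is `D x / P x`, and `P x * klFun (D x / P x)` is the term at `x`. Without absolute
-- continuity some term is `⊤`.
lemma klDivergence_le_tsum_klTerm {X : Type*} [Countable X] (D P : PMF X) :
    klDivergence D P ≤ ∑' x, klTerm (D x) (P x) := by
  let _ : MeasurableSpace X := ⊤
  have : DiscreteMeasurableSpace X := ⟨fun _ => trivial⟩
  by_cases hac : ∀ x, P x = 0 → D x = 0
  · have hD : D.toMeasure = P.toMeasure.withDensity fun x => D x / P x := by
      refine Measure.ext_of_singleton fun x => ?_
      rw [withDensity_apply _ (measurableSet_singleton x), lintegral_singleton,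
        PMF.toMeasure_apply_singleton _ _ (measurableSet_singleton x),
        PMF.toMeasure_apply_singleton _ _ (measurableSet_singleton x)]
      exact (ENNReal.div_mul_cancel' (hac x) fun h => absurd h (P.apply_ne_top x)).symm
    have hr : D.toMeasure.rnDeriv P.toMeasure =ᵐ[P.toMeasure] fun x => D x / P x := by
      rw [hD]; exact Measure.rnDeriv_withDensity _ measurable_from_top
    have hle : D.toMeasure ≪ P.toMeasure := hD ▸ withDensity_absolutelyContinuous _ _
    change InformationTheory.klDiv D.toMeasure P.toMeasure ≤ _
    rw [InformationTheory.klDiv_eq_lintegral_klFun_of_ac hle,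
      lintegral_congr_ae (g := fun x => ENNReal.ofReal (InformationTheory.klFun
        (D x / P x).toReal)) (hr.mono fun x hx => by simp only [hx]), lintegral_countable']
    refine ENNReal.tsum_le_tsum fun x => ?_
    rw [PMF.toMeasure_apply_singleton _ _ (measurableSet_singleton x)]
    by_cases hp : P x = 0
    · simp [hp]
    · rw [klTerm_of_ne_zero hp]
      have hp0 := ENNReal.toReal_pos hp (P.apply_ne_top x)
      conv_lhs => rw [← ENNReal.ofReal_toReal (P.apply_ne_top x),
        ← ENNReal.ofReal_mul' ENNReal.toReal_nonneg]
      apply le_of_eq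
      congr 1
      rw [InformationTheory.klFun_apply, ENNReal.toReal_div, ENNReal.toReal_ofReal hp0.le]
      field_simp
  · push Not at hac
    obtain ⟨x, hx, hx'⟩ := hac
    rw [ENNReal.tsum_eq_top_of_eq_top ⟨x, by rw [hx, klTerm_zero_right hx']⟩]
    exact le_top

/-! ### Expectations over independent samples -/

lemma tsum_bind_mul {X Y : Type*} (p : PMF X) (f : X → PMF Y) (g : Y → ℝ≥0∞) :
    ∑' y, p.bind f y * g y = ∑' x, p x * ∑' y, f x y * g y := by
  simp_rw [PMF.bind_apply, ← ENNReal.tsum_mul_right, ← ENNReal.tsum_mul_left]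
  rw [ENNReal.tsum_comm]
  simp_rw [mul_assoc]

lemma tsum_pure_mul {X : Type*} (a : X) (g : X → ℝ≥0∞) : ∑' x, PMF.pure a x * g x = g a := by
  rw [tsum_eq_single a fun b hb => by simp [PMF.pure_apply, hb]]
  simp

lemma tsum_iidSample_succ_mul {X : Type*} (D : PMF X) (m : ℕ) (g : List X → ℝ≥0∞) :
    ∑' S, iidSample D (m + 1) S * g S =
      ∑' S, iidSample D m S * ∑' x, D x * g (x :: S) := by
  have h : ∀ x, ∑' S, ((iidSample D m).map fun S => x :: S) S * g S =
      ∑' S, iidSample D m S * g (x :: S) := fun x => by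
    rw [PMF.map, tsum_bind_mul]
    exact tsum_congr fun S => by rw [Function.comp_apply, tsum_pure_mul]
  rw [iidSample, tsum_bind_mul]
  simp_rw [h, ← ENNReal.tsum_mul_left]
  rw [ENNReal.tsum_comm]
  exact tsum_congr fun S => tsum_congr fun x => mul_left_comm _ _ _

/-- A property of samples that is inherited by extensions with points of the support of `D` holds
for every sample of positive probability. -/
lemma iidSample_induction {X : Type*} (D : PMF X) {p : ℕ → List X → Prop} (nil : p 0 [])
    (cons : ∀ m S x, p m S → D x ≠ 0 → p (m + 1) (x :: S)) :
    ∀ m S, iidSample D m S ≠ 0 → p m S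
  | 0, S, hS => by
    have : S = [] := by
      by_contra h
      exact hS (by simp [iidSample, PMF.pure_apply, h])
    exact this ▸ nil
  | m + 1, S, hS => by
    rw [← PMF.mem_support_iff, iidSample, PMF.mem_support_bind_iff] at hS
    obtain ⟨x, hx, hS⟩ := hS
    obtain ⟨T, hT, rfl⟩ := (PMF.mem_support_map_iff _ _ _).1 hS
    exact cons m T x (iidSample_induction D nil cons m T ((PMF.mem_support_iff _ _).1 hT))
      ((PMF.mem_support_iff _ _).1 hx)

lemma length_of_iidSample_ne_zero {X : Type*} (D : PMF X) {m : ℕ} {S : List X}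
    (hS : iidSample D m S ≠ 0) : S.length = m :=
  iidSample_induction D (p := fun m S => S.length = m) rfl (fun _ _ _ h _ => by simp [h]) m S hS

/-! ### Bayesian prediction and its expected loss -/

section Bayes

variable {ι X : Type*}

/-- The likelihood of the sample `S` under the hypothesis `i`, up to a factor independent of `i`,
where `num i x` is the probability of `x` under `i` up to such a factor. -/
def sampleWeight (num : ι → X → ℕ) (S : List X) (i : ι) : ℕ := (S.map (num i)).prod

/-- Almost surely the truth keeps positive posterior, so the fallback of `bayesPredictive` is
irrelevant to the loss. -/
lemma sampleWeight_ne_zero {D : ι → PMF X} {num : ι → X → ℕ} {den : X → ℕ}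
    (hD : ∀ i x, D i x = (num i x : ℝ≥0∞) / den x) (j : ι) (m : ℕ) (S : List X)
    (hS : iidSample (D j) m S ≠ 0) : sampleWeight num S j ≠ 0 := by
  refine iidSample_induction (D j) (p := fun _ S => sampleWeight num S j ≠ 0)
    (by simp [sampleWeight]) (fun _ S x h hx => ?_) m S hS
  rw [sampleWeight, List.map_cons, List.prod_cons]
  refine mul_ne_zero (fun h0 => hx ?_) h
  rw [hD, h0]
  simp

variable [Fintype ι]

/-- The sum of the likelihoods of the sample `S` under all hypotheses. -/
def totalWeight (num : ι → X → ℕ) (S : List X) : ℕ := ∑ i, sampleWeight num S i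

lemma totalWeight_cons (num : ι → X → ℕ) (x : X) (S : List X) :
    totalWeight num (x :: S) = ∑ i, num i x * sampleWeight num S i := by
  simp [totalWeight, sampleWeight]

lemma sampleWeight_le_totalWeight (num : ι → X → ℕ) (S : List X) (i : ι) :
    sampleWeight num S i ≤ totalWeight num S :=
  Finset.single_le_sum (f := sampleWeight num S) (fun _ _ => Nat.zero_le _) (Finset.mem_univ i)

/-- The mixture of the distributions `D i` with weights proportional to the likelihoods of the
sample `S`. -/
noncomputable def likelihoodMixture (D : ι → PMF X) (num : ι → X → ℕ) (S : List X)
    (h : totalWeight num S ≠ 0) : PMF X :=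
  ⟨fun x => (∑ i, sampleWeight num S i * D i x) / totalWeight num S, by
    rw [ENNReal.summable.hasSum_iff]
    simp_rw [div_eq_mul_inv]
    rw [ENNReal.tsum_mul_right, Summable.tsum_finsetSum fun _ _ => ENNReal.summable]
    simp_rw [ENNReal.tsum_mul_left, PMF.tsum_coe, mul_one]
    rw [← Nat.cast_sum]
    exact ENNReal.mul_inv_cancel (by exact_mod_cast h) (ENNReal.natCast_ne_top _)⟩

/-- The mixture of the distributions `D i` by the posterior probabilities of the hypotheses `i`
after the sample `S`, starting from the uniform prior; it is `D i₀` if the sample is impossible. -/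
noncomputable def bayesPredictive (D : ι → PMF X) (num : ι → X → ℕ) (i₀ : ι) (S : List X) :
    PMF X :=
  if h : totalWeight num S = 0 then D i₀ else likelihoodMixture D num S h

lemma bayesPredictive_apply {D : ι → PMF X} {num : ι → X → ℕ} {den : X → ℕ}
    (hD : ∀ i x, D i x = (num i x : ℝ≥0∞) / den x) (i₀ : ι) {S : List X}
    (h : totalWeight num S ≠ 0) (x : X) :
    bayesPredictive D num i₀ S x =
      (totalWeight num (x :: S) : ℝ≥0∞) / (totalWeight num S * den x : ℕ) := by
  rw [bayesPredictive, dif_neg h]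
  change (∑ i, sampleWeight num S i * D i x) / (totalWeight num S : ℝ≥0∞) = _
  simp_rw [hD, totalWeight_cons]
  push_cast
  rw [ENNReal.div_eq_inv_mul, ENNReal.div_eq_inv_mul, ENNReal.mul_inv (by simp [h]) (by simp),
    mul_assoc]
  congr 1
  rw [Finset.mul_sum]
  exact Finset.sum_congr rfl fun i _ => by rw [ENNReal.div_eq_inv_mul]; ring

/-- The sum of the probabilities of a point under the predictive distributions after all suffixes
of a sample. -/
noncomputable def predictiveSum (D : ι → PMF X) (num : ι → X → ℕ) (i₀ : ι) : List X → X → ℝ≥0∞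
  | [], x => bayesPredictive D num i₀ [] x
  | y :: S, x => bayesPredictive D num i₀ (y :: S) x + predictiveSum D num i₀ S x

lemma tsum_predictiveSum (D : ι → PMF X) (num : ι → X → ℕ) (i₀ : ι) (S : List X) :
    ∑' x, predictiveSum D num i₀ S x = S.length + 1 := by
  induction S with
  | nil => simp [predictiveSum, PMF.tsum_coe]
  | cons y S ih =>
    simp_rw [predictiveSum]
    rw [ENNReal.tsum_add, ih, PMF.tsum_coe, List.length_cons]
    push_cast
    ring

lemma predictiveSum_ne_top (D : ι → PMF X) (num : ι → X → ℕ) (i₀ : ι) (S : List X) (x : X) :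
    predictiveSum D num i₀ S x ≠ ⊤ := by
  refine ne_top_of_le_ne_top ?_ (ENNReal.le_tsum x)
  rw [tsum_predictiveSum]
  exact_mod_cast ENNReal.natCast_ne_top (S.length + 1)

/-- The average of the predictive distributions after all suffixes of a sample. -/
noncomputable def bayesAverage (D : ι → PMF X) (num : ι → X → ℕ) (i₀ : ι) (S : List X) : PMF X :=
  ⟨fun x => predictiveSum D num i₀ S x / (S.length + 1 : ℕ), by
    rw [ENNReal.summable.hasSum_iff]
    simp_rw [div_eq_mul_inv]
    rw [ENNReal.tsum_mul_right, tsum_predictiveSum]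
    push_cast
    exact ENNReal.mul_inv_cancel (by simp) (by simp)⟩

lemma bayesAverage_apply (D : ι → PMF X) (num : ι → X → ℕ) (i₀ : ι) (S : List X) (x : X) :
    bayesAverage D num i₀ S x = predictiveSum D num i₀ S x / (S.length + 1 : ℕ) := rfl

/-- The loss of the predictive distribution after the sample `S` when the data come from `D j`. -/
noncomputable def predictiveLoss (D : ι → PMF X) (num : ι → X → ℕ) (i₀ j : ι) (S : List X) :
    ℝ≥0∞ :=
  ∑' x, klTerm (D j x) (bayesPredictive D num i₀ S x)

/-- The total loss of the predictive distributions after all proper suffixes of a sample. -/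
noncomputable def cumulativeLoss (D : ι → PMF X) (num : ι → X → ℕ) (i₀ j : ι) : List X → ℝ≥0∞
  | [] => 0
  | _ :: S => predictiveLoss D num i₀ j S + cumulativeLoss D num i₀ j S

/-- The logarithm of the inverse posterior probability of the hypothesis `j`. -/
noncomputable def logPosterior (num : ι → X → ℕ) (j : ι) (S : List X) : ℝ≥0∞ :=
  ENNReal.ofReal (Real.log (totalWeight num S / sampleWeight num S j))

lemma predictiveLoss_add_le {D : ι → PMF X} {num : ι → X → ℕ} {den : X → ℕ}
    (hden : ∀ x, den x ≠ 0) (hD : ∀ i x, D i x = (num i x : ℝ≥0∞) / den x) (i₀ j : ι)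
    {S : List X} (h : sampleWeight num S j ≠ 0) :
    predictiveLoss D num i₀ j S + ∑' x, D j x * logPosterior num j (x :: S) ≤
      logPosterior num j S := by
  have hW : totalWeight num S ≠ 0 := fun h0 =>
    h (Nat.le_zero.1 (h0 ▸ sampleWeight_le_totalWeight num S j))
  set w : ℝ := ((sampleWeight num S j : ℕ) : ℝ) with hw
  set W : ℝ := ((totalWeight num S : ℕ) : ℝ) with hWdef
  have wpos : 0 < w := by rw [hw]; exact_mod_cast Nat.pos_of_ne_zero h
  have Wpos : 0 < W := by rw [hWdef]; exact_mod_cast Nat.pos_of_ne_zero hW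
  have hwW : w ≤ W := by rw [hw, hWdef]; exact_mod_cast sampleWeight_le_totalWeight num S j
  have key : ∀ x, klTerm (D j x) (bayesPredictive D num i₀ S x) +
      D j x * logPosterior num j (x :: S) + D j x =
      D j x * logPosterior num j S + bayesPredictive D num i₀ S x := fun x => by
    have hdx : (0 : ℝ) < den x := by exact_mod_cast Nat.pos_of_ne_zero (hden x)
    have hd : (D j x).toReal = num j x / den x := by rw [hD]; simp
    have hp : (bayesPredictive D num i₀ S x).toReal = totalWeight num (x :: S) / (W * den x) := by
      rw [bayesPredictive_apply hD i₀ hW, hWdef]; simp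
    have hs : (sampleWeight num (x :: S) j : ℝ) = num j x * w := by
      rw [hw, sampleWeight, List.map_cons, List.prod_cons, Nat.cast_mul, sampleWeight]
    have hle : (num j x * w : ℝ) ≤ totalWeight num (x :: S) := by
      rw [← hs]; exact_mod_cast sampleWeight_le_totalWeight num (x :: S) j
    have := klTerm_add_mul_log (r := w / W) ((D j).apply_ne_top x)
      ((bayesPredictive D num i₀ S).apply_ne_top x) (div_pos wpos Wpos)
      ((div_le_one Wpos).2 hwW) (by
        rw [hd, hp, div_mul_div_comm, mul_comm w]
        gcongr)
    rw [one_div_div, hd, hp, div_mul_div_comm, div_div_div_cancel_right₀ (by positivity),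
      mul_comm w, ← hs] at this
    exact this
  -- Summed over `x`, the extra terms `D j x` and the predictive probabilities both give `1` and
  -- cancel.
  have hsum := congrArg (fun g : X → ℝ≥0∞ => ∑' x, g x) (funext key)
  simp_rw [ENNReal.tsum_add, ENNReal.tsum_mul_right, PMF.tsum_coe, one_mul] at hsum
  exact (ENNReal.add_left_inj ENNReal.one_ne_top).1 hsum |>.le

lemma tsum_iidSample_mul_cumulativeLoss_le {D : ι → PMF X} {num : ι → X → ℕ} {den : X → ℕ}
    (hden : ∀ x, den x ≠ 0) (hD : ∀ i x, D i x = (num i x : ℝ≥0∞) / den x) (i₀ j : ι) (m : ℕ) :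
    ∑' S, iidSample (D j) m S * (cumulativeLoss D num i₀ j S + logPosterior num j S) ≤
      ENNReal.ofReal (Real.log (Fintype.card ι)) := by
  induction m with
  | zero =>
    rw [iidSample, tsum_pure_mul]
    -- On the empty sample every likelihood is `1`, so the potential is `log card`.
    simp [cumulativeLoss, logPosterior, totalWeight, sampleWeight]
  | succ m ih =>
    rw [tsum_iidSample_succ_mul]
    refine le_trans (ENNReal.tsum_le_tsum fun S => ?_) ih
    by_cases hS : iidSample (D j) m S = 0
    · simp [hS]
    refine mul_le_mul_right ?_ _
    simp_rw [cumulativeLoss, mul_add, ENNReal.tsum_add, ENNReal.tsum_mul_right, PMF.tsum_coe,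
      one_mul]
    rw [add_comm (predictiveLoss D num i₀ j S), add_assoc]
    gcongr
    exact predictiveLoss_add_le hden hD i₀ j (sampleWeight_ne_zero hD j m S hS)

/-- Iterated subadditivity: `S.length + 1` copies of `D j` are paired with the predictions after the
suffixes of `S`. -/
lemma tsum_klTerm_predictiveSum_le (D : ι → PMF X) (num : ι → X → ℕ) (i₀ j : ι) (S : List X) :
    ∑' x, klTerm ((S.length + 1 : ℕ) * D j x) (predictiveSum D num i₀ S x) ≤
      cumulativeLoss D num i₀ j S + predictiveLoss D num i₀ j S := by
  induction S with
  | nil => simp [cumulativeLoss, predictiveLoss, predictiveSum]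
  | cons y S ih =>
    rw [cumulativeLoss, add_comm (predictiveLoss D num i₀ j S)]
    refine le_trans ?_ (add_le_add_left ih _)
    rw [predictiveLoss, ← ENNReal.tsum_add]
    refine ENNReal.tsum_le_tsum fun x => ?_
    have e : ((S.length + 1 + 1 : ℕ) : ℝ≥0∞) * D j x = D j x + (S.length + 1 : ℕ) * D j x := by
      push_cast
      ring
    rw [predictiveSum, List.length_cons, e]
    exact (klTerm_add_le ((D j).apply_ne_top x)
      (ENNReal.mul_ne_top (ENNReal.natCast_ne_top _) ((D j).apply_ne_top x))
      ((bayesPredictive D num i₀ _).apply_ne_top x)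
      (predictiveSum_ne_top D num i₀ S x)).trans_eq (add_comm _ _)

lemma mul_klDivergence_bayesAverage_le [Countable X] (D : ι → PMF X) (num : ι → X → ℕ)
    (i₀ j : ι) (S : List X) :
    (S.length + 1 : ℕ) * klDivergence (D j) (bayesAverage D num i₀ S) ≤
      cumulativeLoss D num i₀ j S + predictiveLoss D num i₀ j S := by
  refine le_trans (mul_le_mul_right (klDivergence_le_tsum_klTerm _ _) _) ?_
  refine le_trans (le_of_eq ?_) (tsum_klTerm_predictiveSum_le D num i₀ j S)
  rw [← ENNReal.tsum_mul_left]
  refine tsum_congr fun x => ?_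
  rw [← klTerm_mul (by simp) (ENNReal.natCast_ne_top _), bayesAverage_apply,
    ENNReal.mul_div_cancel (by simp) (ENNReal.natCast_ne_top _)]

/-- The expected divergence of the averaged predictive distribution is at most `log card / m`. -/
lemma tsum_iidSample_mul_klDivergence_le [Countable X] {D : ι → PMF X} {num : ι → X → ℕ}
    {den : X → ℕ} (hden : ∀ x, den x ≠ 0) (hD : ∀ i x, D i x = (num i x : ℝ≥0∞) / den x)
    (i₀ j : ι) (m : ℕ) :
    (m + 1 : ℕ) * ∑' S, iidSample (D j) m S * klDivergence (D j) (bayesAverage D num i₀ S) ≤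
      ENNReal.ofReal (Real.log (Fintype.card ι)) := by
  refine le_trans ?_ (tsum_iidSample_mul_cumulativeLoss_le hden hD i₀ j m)
  rw [← ENNReal.tsum_mul_left]
  refine ENNReal.tsum_le_tsum fun S => ?_
  by_cases hS : iidSample (D j) m S = 0
  · simp [hS]
  rw [mul_left_comm, ← length_of_iidSample_ne_zero _ hS]
  refine mul_le_mul_right ((mul_klDivergence_bayesAverage_le D num i₀ j S).trans ?_) _
  gcongr
  -- The loss after the whole sample is paid by the remaining potential; hence `m + 1` predictions
  -- from `m` draws.
  exact le_self_add.trans (predictiveLoss_add_le hden hD i₀ j (sampleWeight_ne_zero hD j m S hS))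

end Bayes

/-! ### From expectation to probability -/

/-- Markov's inequality for a discrete distribution. -/
lemma ofReal_one_sub_le_toOuterMeasure {X : Type*} (p : PMF X) (f : X → ℝ≥0∞) {ε δ : ℝ}
    (hε : 0 < ε) (hδ : 0 < δ) (h : ∑' x, p x * f x ≤ ENNReal.ofReal (ε * δ)) :
    ENNReal.ofReal (1 - δ) ≤ p.toOuterMeasure {x | f x ≤ ENNReal.ofReal ε} := by
  rw [ENNReal.ofReal_sub _ hδ.le, ENNReal.ofReal_one, tsub_le_iff_right]
  have hsplit : 1 ≤ p.toOuterMeasure {x | f x ≤ ENNReal.ofReal ε} +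
      p.toOuterMeasure {x | f x ≤ ENNReal.ofReal ε}ᶜ := by
    rw [PMF.toOuterMeasure_apply, PMF.toOuterMeasure_apply, ← ENNReal.tsum_add, ← p.tsum_coe]
    refine (tsum_congr fun x => ?_).le
    exact (congrFun (Set.indicator_self_add_compl _ _) x).symm
  refine hsplit.trans (add_le_add_right ?_ _)
  have hε' : ENNReal.ofReal ε ≠ 0 := by simpa using hε
  rw [← ENNReal.mul_le_mul_iff_right hε' ENNReal.ofReal_ne_top, ← ENNReal.ofReal_mul hε.le]
  refine le_trans ?_ h
  rw [PMF.toOuterMeasure_apply, ← ENNReal.tsum_mul_left]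
  refine ENNReal.tsum_le_tsum fun x => ?_
  by_cases hx : f x ≤ ENNReal.ofReal ε
  · simp [hx]
  · rw [Set.indicator_of_mem (by simpa using hx), mul_comm]
    exact mul_le_mul_right (not_le.1 hx).le _

/-! ### Computability of the averaged prediction -/

lemma ENNReal.natCast_div_add_natCast_div {a b p q : ℕ} (hb : b ≠ 0) (hq : q ≠ 0) :
    (a : ℝ≥0∞) / b + (p : ℝ≥0∞) / q = ((a * q + p * b : ℕ) : ℝ≥0∞) / (b * q : ℕ) := by
  have hb' : (b : ℝ≥0∞) ≠ 0 := by exact_mod_cast hb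
  have hq' : (q : ℝ≥0∞) ≠ 0 := by exact_mod_cast hq
  push_cast
  rw [ENNReal.add_div, ENNReal.mul_div_mul_right _ _ hq' (ENNReal.natCast_ne_top _),
    mul_comm (b : ℝ≥0∞), ENNReal.mul_div_mul_right _ _ hb' (ENNReal.natCast_ne_top _)]

lemma Primrec.finset_sum {ι X : Type*} [Primcodable X] (s : Finset ι) {f : ι → X → ℕ}
    (h : ∀ i, Primrec (f i)) : Primrec fun x => ∑ i ∈ s, f i x := by
  classical
  induction s using Finset.induction_on with
  | empty => simpa using Primrec.const 0
  | insert i s hi ih =>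
    simp_rw [Finset.sum_insert hi]
    exact Primrec.nat_add.comp (h i) ih

section Bayes

variable {ι X : Type*} [Fintype ι]

/-- Numerator and denominator of the probability of `x` under the predictive distribution after
the sample `S`. -/
def predictiveFraction (num : ι → X → ℕ) (den : X → ℕ) (i₀ : ι) (x : X) (S : List X) : ℕ × ℕ :=
  if totalWeight num S = 0 then (num i₀ x, den x)
  else (totalWeight num (x :: S), totalWeight num S * den x)

/-- Sum of two fractions. -/
def addFraction (r s : ℕ × ℕ) : ℕ × ℕ := (r.1 * s.2 + s.1 * r.2, r.2 * s.2)

/-- Numerator and denominator of `predictiveSum`. -/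
def predictiveSumFraction (num : ι → X → ℕ) (den : X → ℕ) (i₀ : ι) (x : X) (S : List X) : ℕ × ℕ :=
  List.recOn S (predictiveFraction num den i₀ x []) fun y S r =>
    addFraction (predictiveFraction num den i₀ x (y :: S)) r

lemma predictiveFraction_spec {D : ι → PMF X} {num : ι → X → ℕ} {den : X → ℕ}
    (hden : ∀ x, den x ≠ 0) (hD : ∀ i x, D i x = (num i x : ℝ≥0∞) / den x) (i₀ : ι) (x : X)
    (S : List X) :
    (predictiveFraction num den i₀ x S).2 ≠ 0 ∧
      bayesPredictive D num i₀ S x = ((predictiveFraction num den i₀ x S).1 : ℝ≥0∞) /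
        (predictiveFraction num den i₀ x S).2 := by
  by_cases h : totalWeight num S = 0
  · rw [predictiveFraction, if_pos h, bayesPredictive, dif_pos h]
    exact ⟨hden x, hD i₀ x⟩
  · rw [predictiveFraction, if_neg h, bayesPredictive_apply hD i₀ h]
    exact ⟨mul_ne_zero h (hden x), rfl⟩

lemma predictiveSumFraction_spec {D : ι → PMF X} {num : ι → X → ℕ} {den : X → ℕ}
    (hden : ∀ x, den x ≠ 0) (hD : ∀ i x, D i x = (num i x : ℝ≥0∞) / den x) (i₀ : ι) (x : X)
    (S : List X) :
    (predictiveSumFraction num den i₀ x S).2 ≠ 0 ∧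
      predictiveSum D num i₀ S x = ((predictiveSumFraction num den i₀ x S).1 : ℝ≥0∞) /
        (predictiveSumFraction num den i₀ x S).2 := by
  induction S with
  | nil => exact predictiveFraction_spec hden hD i₀ x []
  | cons y S ih =>
    obtain ⟨h₁, h₂⟩ := predictiveFraction_spec hden hD i₀ x (y :: S)
    refine ⟨mul_ne_zero h₁ ih.1, ?_⟩
    rw [predictiveSum, h₂, ih.2]
    exact ENNReal.natCast_div_add_natCast_div h₁ ih.1

variable [Primcodable X]

lemma primrec_totalWeight {num : ι → X → ℕ} (hnum : ∀ i, Primrec (num i)) :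
    Primrec (totalWeight num) := by
  refine Primrec.finset_sum _ fun i => ?_
  refine (Primrec.list_foldr (h := fun _ b => num i b.1 * b.2) Primrec.id (Primrec.const 1)
    (Primrec.nat_mul.comp ((hnum i).comp (Primrec.fst.comp Primrec.snd))
      (Primrec.snd.comp Primrec.snd)).to₂).of_eq fun S => ?_
  induction S with
  | nil => rfl
  | cons y S ih => simpa [sampleWeight] using Or.inl ih

lemma primrec_predictiveFraction {num : ι → X → ℕ} {den : X → ℕ} (hnum : ∀ i, Primrec (num i))
    (hden : Primrec den) (i₀ : ι) : Primrec₂ (predictiveFraction num den i₀) := by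
  have hW := primrec_totalWeight hnum
  exact Primrec.ite (Primrec.eq.comp (hW.comp Primrec.snd) (Primrec.const 0))
    (((hnum i₀).comp Primrec.fst).pair (hden.comp Primrec.fst))
    ((hW.comp (Primrec.list_cons.comp Primrec.fst Primrec.snd)).pair
      (Primrec.nat_mul.comp (hW.comp Primrec.snd) (hden.comp Primrec.fst)))

lemma primrec_addFraction : Primrec₂ addFraction := by
  have r₁ : Primrec fun p : (ℕ × ℕ) × (ℕ × ℕ) => p.1.1 := Primrec.fst.comp Primrec.fst
  have r₂ : Primrec fun p : (ℕ × ℕ) × (ℕ × ℕ) => p.1.2 := Primrec.snd.comp Primrec.fst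
  have s₁ : Primrec fun p : (ℕ × ℕ) × (ℕ × ℕ) => p.2.1 := Primrec.fst.comp Primrec.snd
  have s₂ : Primrec fun p : (ℕ × ℕ) × (ℕ × ℕ) => p.2.2 := Primrec.snd.comp Primrec.snd
  exact (Primrec.nat_add.comp (Primrec.nat_mul.comp r₁ s₂) (Primrec.nat_mul.comp s₁ r₂)).pair
    (Primrec.nat_mul.comp r₂ s₂)

lemma primrec_predictiveSumFraction {num : ι → X → ℕ} {den : X → ℕ}
    (hnum : ∀ i, Primrec (num i)) (hden : Primrec den) (i₀ : ι) :
    Primrec₂ (predictiveSumFraction num den i₀) := by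
  have hF := primrec_predictiveFraction hnum hden i₀
  refine Primrec.list_rec (f := fun p : X × List X => p.2)
    (g := fun p => predictiveFraction num den i₀ p.1 [])
    (h := fun p q => addFraction (predictiveFraction num den i₀ p.1 (q.1 :: q.2.1)) q.2.2)
    Primrec.snd (hF.comp Primrec.fst (Primrec.const [])) ?_
  have q : Primrec fun z : (X × List X) × X × List X × (ℕ × ℕ) => z.2 := Primrec.snd
  have q₂ := Primrec.snd.comp q
  exact primrec_addFraction.comp
    (hF.comp (Primrec.fst.comp Primrec.fst)
      (Primrec.list_cons.comp (Primrec.fst.comp q) (Primrec.fst.comp q₂)))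
    (Primrec.snd.comp q₂)

lemma isComputableLearner_bayesAverage {D : ι → PMF X} {num : ι → X → ℕ} {den : X → ℕ}
    (hden : ∀ x, den x ≠ 0) (hD : ∀ i x, D i x = (num i x : ℝ≥0∞) / den x)
    (hnum : ∀ i, Primrec (num i)) (hden' : Primrec den) (i₀ : ι) :
    IsComputableLearner fun _ _ S => bayesAverage D num i₀ S := by
  refine ⟨fun z => ((predictiveSumFraction num den i₀ z.2 z.1.2.2).1,
    (predictiveSumFraction num den i₀ z.2 z.1.2.2).2 * (z.1.2.2.length + 1)),
    Primrec.to_comp ?_, fun a b S x => ?_⟩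
  · have hS : Primrec fun z : (ℕ × ℕ × List X) × X => z.1.2.2 :=
      Primrec.snd.comp (Primrec.snd.comp Primrec.fst)
    have hF := (primrec_predictiveSumFraction hnum hden' i₀).comp
      (Primrec.snd (α := ℕ × ℕ × List X) (β := X)) hS
    exact (Primrec.fst.comp hF).pair (Primrec.nat_mul.comp (Primrec.snd.comp hF)
      (Primrec.succ.comp (Primrec.list_length.comp hS)))
  · rw [bayesAverage_apply, (predictiveSumFraction_spec hden hD i₀ x S).2, Nat.cast_mul,
      div_eq_mul_inv, div_eq_mul_inv, div_eq_mul_inv, mul_assoc, ENNReal.mul_inv (by simp) (by simp)]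

end Bayes

/-! ### Word probabilities as integer fractions -/

section Automata

variable {n : ℕ} {α : Type*}

/-- The analogue of `pdfaWeight` for natural-number weights, as a loop over the word. -/
def automatonWeight (next : Fin n → α → Fin n) (c : Fin n → Option α → ℕ) (q : Fin n)
    (w : List α) : ℕ :=
  let r := w.foldl (fun s a => (next s.1 a, s.2 * c s.1 (some a))) (q, 1)
  r.2 * c r.1 none

lemma primrec_automatonWeight [Finite α] [Primcodable α] (next : Fin n → α → Fin n)
    (c : Fin n → Option α → ℕ) (q : Fin n) : Primrec (automatonWeight next c q) := by
  have hr : Primrec fun w : List α =>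
      w.foldl (fun s a => (next s.1 a, s.2 * c s.1 (some a))) (q, 1) := by
    refine Primrec.list_foldl (h := fun _ z => (next z.1.1 z.2, z.1.2 * c z.1.1 (some z.2)))
      Primrec.id (Primrec.const (q, 1)) ?_
    have hz : Primrec fun z : List α × (Fin n × ℕ) × α => (z.2.1.1, z.2.2) :=
      (Primrec.fst.comp (Primrec.fst.comp Primrec.snd)).pair (Primrec.snd.comp Primrec.snd)
    exact ((Primrec.dom_finite fun y : Fin n × α => next y.1 y.2).comp hz).pair
      (Primrec.nat_mul.comp (Primrec.snd.comp (Primrec.fst.comp Primrec.snd))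
        ((Primrec.dom_finite fun y : Fin n × α => c y.1 (some y.2)).comp hz))
  exact Primrec.nat_mul.comp (Primrec.snd.comp hr)
    ((Primrec.dom_finite fun q => c q none).comp (Primrec.fst.comp hr))

lemma pdfaWeight_eq_automatonWeight_div {next : Fin n → α → Fin n}
    {prob : Fin n → Option α → ℝ≥0} {c : Fin n → Option α → ℕ} {Q : ℕ}
    (h : ∀ q o, prob q o = (c q o : ℝ≥0) / Q) (q : Fin n) (w : List α) :
    pdfaWeight next prob q w = (automatonWeight next c q w : ℝ≥0) / (Q ^ (w.length + 1) : ℕ) := by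
  -- The initial value of the accumulator is generalised to `k` for the induction.
  have key : ∀ (w : List α) (q : Fin n) (k : ℕ),
      ((let r := w.foldl (fun s a => (next s.1 a, s.2 * c s.1 (some a))) (q, k)
        r.2 * c r.1 none : ℕ) : ℝ≥0) / (Q ^ (w.length + 1) : ℕ) =
      k * pdfaWeight next prob q w := by
    intro w
    induction w with
    | nil => intro q k; simp [pdfaWeight, h, mul_div_assoc]
    | cons a w ih =>
      intro q k
      rw [pdfaWeight, h, List.foldl_cons, List.length_cons, pow_succ, Nat.cast_mul (Q ^ _) Q,
        ← div_div]
      refine (congrArg (· / (Q : ℝ≥0)) (ih (next q a) (k * c q (some a)))).trans ?_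
      push_cast
      ring
  simpa [automatonWeight] using (key w q 1).symm

end Automata

/-! ### Size of the class and a common denominator -/

section PDFAClass

variable {n l : ℕ} {α : Type*} [Fintype α]

/-- A PDFA given by bit strings is determined by its initial state, its transitions and the bit
strings of its probabilities. -/
lemma exists_pdfa_code (val : (Fin l → Bool) → ℚ≥0) :
    ∃ code : {A : PDFA n α // A.HasBitProbs val} →
      Fin n × (Fin n → α → Fin n) × (Fin n → Option α → Fin l → Bool), code.Injective := by
  choose b hb using fun A : {A : PDFA n α // A.HasBitProbs val} => A.2
  refine ⟨fun A => (A.1.start, A.1.next, b A), fun A B h => ?_⟩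
  simp only [Prod.mk.injEq] at h
  have hp : A.1.prob = B.1.prob := by
    funext q o
    rw [hb A, hb B, h.2.2]
  obtain ⟨⟨s, t, p, _, _⟩, _⟩ := A
  obtain ⟨⟨s', t', p', _, _⟩, _⟩ := B
  obtain ⟨h₁, h₂, -⟩ := h
  dsimp only at h₁ h₂ hp
  subst h₁ h₂ hp
  rfl

lemma finite_hasBitProbs (val : (Fin l → Bool) → ℚ≥0) :
    Finite {A : PDFA n α // A.HasBitProbs val} := by
  classical
  obtain ⟨code, hcode⟩ := exists_pdfa_code (n := n) (α := α) val
  exact Finite.of_injective code hcode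

lemma log_card_hasBitProbs_le (val : (Fin l → Bool) → ℚ≥0)
    [Fintype {A : PDFA n α // A.HasBitProbs val}] [Nonempty {A : PDFA n α // A.HasBitProbs val}] :
    Real.log (Fintype.card {A : PDFA n α // A.HasBitProbs val}) ≤
      (n + n * n * Fintype.card α + l * n * (Fintype.card α + 1) : ℕ) := by
  classical
  obtain ⟨code, hcode⟩ := exists_pdfa_code (n := n) (α := α) val
  have hn : n ≠ 0 := fun h0 => by
    obtain ⟨A⟩ := ‹Nonempty {A : PDFA n α // A.HasBitProbs val}›
    exact (h0 ▸ A.1.start).elim0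
  have hn' : (n : ℝ) ≠ 0 := by exact_mod_cast hn
  have hcard := Fintype.card_le_of_injective code hcode
  simp only [Fintype.card_prod, Fintype.card_fun, Fintype.card_fin, Fintype.card_bool,
    Fintype.card_option] at hcard
  have hlog : Real.log n ≤ n := Real.log_le_self (Nat.cast_nonneg n)
  have hlog2 : Real.log 2 ≤ 1 := by linarith [Real.log_le_sub_one_of_pos (x := 2) (by norm_num)]
  calc Real.log (Fintype.card {A : PDFA n α // A.HasBitProbs val})
      ≤ Real.log ((n : ℝ) * (((n : ℝ) ^ Fintype.card α) ^ n *
          (((2 : ℝ) ^ l) ^ (Fintype.card α + 1)) ^ n)) := by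
        refine Real.log_le_log (by exact_mod_cast Fintype.card_pos) ?_
        exact_mod_cast hcard
    _ = Real.log n + n * (Fintype.card α * Real.log n) +
          n * ((Fintype.card α + 1) * (l * Real.log 2)) := by
        rw [Real.log_mul hn' (by positivity), Real.log_mul (by positivity) (by positivity)]
        simp only [Real.log_pow]
        push_cast
        ring
    -- Crude bounds `log n ≤ n` and `log 2 ≤ 1`.
    _ ≤ n + n * (Fintype.card α * n) + n * ((Fintype.card α + 1) * (l * 1)) := by gcongr
    _ = _ := by push_cast; ring

lemma exists_common_denominator (val : (Fin l → Bool) → ℚ≥0) :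
    ∃ Q : ℕ, Q ≠ 0 ∧ ∀ b, ∃ k : ℕ, (val b : ℝ≥0) = (k : ℝ≥0) / Q := by
  refine ⟨∏ b, (val b).den, Finset.prod_ne_zero_iff.2 fun b _ => (val b).den_ne_zero, fun b => ?_⟩
  obtain ⟨m, hm⟩ := Finset.dvd_prod_of_mem (fun b => (val b).den) (Finset.mem_univ b)
  have hQ : ∏ b, (val b).den ≠ 0 := Finset.prod_ne_zero_iff.2 fun b _ => (val b).den_ne_zero
  have hm0 : (m : ℝ≥0) ≠ 0 := by
    rintro h0
    rw [Nat.cast_eq_zero.1 h0, mul_zero] at hm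
    exact hQ hm
  refine ⟨(val b).num * m, ?_⟩
  rw [hm, NNRat.cast_def]
  push_cast
  rw [mul_div_mul_right _ _ hm0]

end PDFAClass

/-! ### The learner -/

lemma isComputableLearner_pure_nil {α : Type*} [Primcodable α] :
    IsComputableLearner fun (_ _ : ℕ) (_ : List (List α)) => PMF.pure ([] : List α) := by
  -- Truncated subtraction makes this the indicator of the empty word.
  refine ⟨fun z => (1 - z.2.length, 1), Primrec.to_comp ?_, fun a b S x => ?_⟩
  · exact (Primrec.nat_sub.comp (Primrec.const 1) (Primrec.list_length.comp Primrec.snd)).pair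
      (Primrec.const 1)
  · cases x with
    | nil => simp
    | cons y x => simp [PMF.pure_apply]

lemma klDivergence_bayesAverage_pac {ι X : Type*} [Fintype ι] [Countable X] {D : ι → PMF X}
    {num : ι → X → ℕ} {den : X → ℕ} (hden : ∀ x, den x ≠ 0)
    (hD : ∀ i x, D i x = (num i x : ℝ≥0∞) / den x) (i₀ j : ι) {m : ℕ} {ε δ : ℝ} (hε : 0 < ε)
    (hδ : 0 < δ) (hm : Real.log (Fintype.card ι) ≤ m * (ε * δ)) :
    ENNReal.ofReal (1 - δ) ≤ (iidSample (D j) m).toOuterMeasure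
      {S | klDivergence (D j) (bayesAverage D num i₀ S) ≤ ENNReal.ofReal ε} := by
  refine ofReal_one_sub_le_toOuterMeasure _ _ hε hδ ?_
  have h := tsum_iidSample_mul_klDivergence_le hden hD i₀ j m
  have hm' : ENNReal.ofReal (Real.log (Fintype.card ι)) ≤
      (m + 1 : ℕ) * ENNReal.ofReal (ε * δ) := by
    rw [← ENNReal.ofReal_natCast, ← ENNReal.ofReal_mul (Nat.cast_nonneg _)]
    refine ENNReal.ofReal_le_ofReal (hm.trans ?_)
    gcongr
    simp
  exact (ENNReal.mul_le_mul_iff_right (by simp) (ENNReal.natCast_ne_top _)).1 (h.trans hm')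

theorem mainTheorem6 :
    ∃ p : MvPolynomial (Fin 5) ℕ,
      ∀ (n l : ℕ) (α : Type*) [Fintype α] [Primcodable α] (val : (Fin l → Bool) → ℚ≥0),
        ∃ H : ℕ → ℕ → List (List α) → PMF (List α),
          IsComputableLearner H ∧
          ∀ (ε δ : ℝ), 0 < ε → 0 < δ →
            ∀ A : PDFA n α, A.HasBitProbs val →
              ENNReal.ofReal (1 - δ) ≤
                (iidSample A.dist
                    (MvPolynomial.eval ![n, Fintype.card α, l, ⌈1 / ε⌉₊, ⌈1 / δ⌉₊] p)).toOuterMeasure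
                  {S | klDivergence A.dist (H ⌈1 / ε⌉₊ ⌈1 / δ⌉₊ S) ≤ ENNReal.ofReal ε} := by
  open MvPolynomial in
  -- The bound on `log card` times `⌈1 / ε⌉₊ * ⌈1 / δ⌉₊`.
  refine ⟨(X 0 + X 0 * X 0 * X 1 + X 2 * X 0 * (X 1 + 1)) * (X 3 * X 4), ?_⟩
  intro n l α _ _ val
  have : Finite {A : PDFA n α // A.HasBitProbs val} := finite_hasBitProbs val
  have : Fintype {A : PDFA n α // A.HasBitProbs val} := Fintype.ofFinite _
  rcases isEmpty_or_nonempty {A : PDFA n α // A.HasBitProbs val} with hE | hN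
  -- For an empty class any computable learner will do.
  · exact ⟨_, isComputableLearner_pure_nil, fun ε δ _ _ A hA => (hE.false ⟨A, hA⟩).elim⟩
  obtain ⟨Q, hQ, hval⟩ := exists_common_denominator val
  have hc : ∀ A : {A : PDFA n α // A.HasBitProbs val}, ∃ c : Fin n → Option α → ℕ,
      ∀ q o, A.1.prob q o = (c q o : ℝ≥0) / Q := fun A => by
    choose b hb using A.2
    choose k hk using hval
    exact ⟨fun q o => k (b q o), fun q o => by rw [hb, hk]⟩
  choose c hc using hc
  let D : {A : PDFA n α // A.HasBitProbs val} → PMF (List α) := fun A => A.1.dist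
  let num : {A : PDFA n α // A.HasBitProbs val} → List α → ℕ :=
    fun A => automatonWeight A.1.next (c A) A.1.start
  let den : List α → ℕ := fun w => Q ^ (w.length + 1)
  have hden : ∀ w, den w ≠ 0 := fun w => pow_ne_zero _ hQ
  have hD : ∀ A w, D A w = (num A w : ℝ≥0∞) / den w := fun A w => by
    change ((pdfaWeight A.1.next A.1.prob A.1.start w : ℝ≥0) : ℝ≥0∞) = _
    rw [pdfaWeight_eq_automatonWeight_div (hc A),
      ENNReal.coe_div (by exact_mod_cast hden w), ENNReal.coe_natCast, ENNReal.coe_natCast]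
  have hden' : Primrec den := by
    refine (Primrec.list_foldr (h := fun _ b => Q * b.2) Primrec.id (Primrec.const Q)
      (Primrec.nat_mul.comp (Primrec.const Q) (Primrec.snd.comp Primrec.snd)).to₂).of_eq
        fun w => ?_
    induction w with
    | nil => simp [den]
    | cons a w ih => simpa [den, pow_succ, mul_comm] using Or.inl ih
  obtain ⟨A₀⟩ := hN
  refine ⟨_, isComputableLearner_bayesAverage hden hD
    (fun A => primrec_automatonWeight _ _ _) hden' A₀, fun ε δ hε hδ A hA => ?_⟩
  refine klDivergence_bayesAverage_pac hden hD A₀ ⟨A, hA⟩ hε hδ ?_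
  have : Nonempty {A : PDFA n α // A.HasBitProbs val} := ⟨A₀⟩
  refine (log_card_hasBitProbs_le val).trans ?_
  have hε' : 1 ≤ (⌈1 / ε⌉₊ : ℝ) * ε := (div_le_iff₀ hε).1 (Nat.le_ceil _)
  have hδ' : 1 ≤ (⌈1 / δ⌉₊ : ℝ) * δ := (div_le_iff₀ hδ).1 (Nat.le_ceil _)
  have h1 : (1 : ℝ) ≤ (⌈1 / ε⌉₊ * ε) * (⌈1 / δ⌉₊ * δ) := one_le_mul_of_one_le_of_one_le hε' hδ'
  have heval : MvPolynomial.eval ![n, Fintype.card α, l, ⌈1 / ε⌉₊, ⌈1 / δ⌉₊]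
      ((MvPolynomial.X 0 + MvPolynomial.X 0 * MvPolynomial.X 0 * MvPolynomial.X 1 +
        MvPolynomial.X 2 * MvPolynomial.X 0 * (MvPolynomial.X 1 + 1)) *
        (MvPolynomial.X 3 * MvPolynomial.X 4)) =
      (n + n * n * Fintype.card α + l * n * (Fintype.card α + 1)) * (⌈1 / ε⌉₊ * ⌈1 / δ⌉₊) := by
    simp
  rw [heval, Nat.cast_mul, Nat.cast_mul ⌈1 / ε⌉₊]
  exact (le_mul_of_one_le_right (Nat.cast_nonneg _) h1).trans_eq (by ring)
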